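/- **Setting.** Let $A$ be a set of actions containing a termination action $\surd$. A *PGSOS specification* $P=(\Sigma,A,R)$ consists of a signature $\Sigma$ (operators with finite ranks) and a set $R$ of rules $$\frac{\{x_i\xrightarrow{a_{i,k}}\mu_{i,k}\mid k\in K_i\}\quad\{x_i\not\xrightarrow{b_{i,l}}\ \mid l\in L_i\}\qquad(1\le i\le n)}{f(x_1,\dots,x_n)\xrightarrow{a}\theta}$$ with $K_i,L_i$ finite, all $x_i$ and all $\mu_{i,k}$ pairwise distinct, and $\theta$ a distribution term built from the $\mu_{i,k}$, Dirac terms $\delta(t)$ with $t$ a term over the $x_i$, convex combinations ($\theta_1\oplus_p\theta_2$ has weights $p$ and $1-p$) and operators of $\Sigma$ (interpreted as product distributions), such that for every operator $f$ and action $a$ only finitely many rules have source operator $f$ and label $a$. It induces a unique transition relation $t\xrightarrow{a}\pi$ between closed $\Sigma$-terms $t\in T(\Sigma)$ and discrete probability distributions $\pi$ on $T(\Sigma)$, containing exactly the transitions justified by an instance of a rule. For $0<\lambda<1$, a *$\lambda$-bisimulation metric* is a $1$-bounded pseudometric $d$ on $T(\Sigma)$ such that whenever $d(t,t')<1$ and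 $t\xrightarrow{a}\pi$ there is $t'\xrightarrow{a}\pi'$ with $\lambda\,\mathbf K(d)(\pi,\pi')\le d(t,t')$, where $\mathbf K(d)(\pi,\pi')=\min_\omega\sum_{u,u'}d(u,u')\,\omega(u,u')$, the minimum being over all distributions $\omega$ on $T(\Sigma)\times T(\Sigma)$ with marginals $\pi,\pi'$. The *$\lambda$-bisimilarity metric* $\mathbf d_\lambda$ is the pointwise smallest $\lambda$-bisimulation metric. **The process algebra.** Let $P_{\mathrm{PA}^\circlearrowleft}$ be the specification with the following operators and rules ($p\in(0,1)$, $B\subseteq A$, $n,m\in\mathbb N$, $a\in A$; rules marked $\dagger$ are restricted to $a\ne\surd$). - $0$: no rule. $\varepsilon$: $\varepsilon\xrightarrow{\surd}\delta(0)$. Prefix ($k\ge1$, $p_i>0$, $\sum_{i=1}^k p_i=1$): $a.\bigoplus_{i=1}^k[p_i]x_i\xrightarrow{a}\sum_{i=1}^k p_i\delta(x_i)$. - $x;y$: $\dfrac{x\xrightarrow a\mu}{x;y\xrightarrow a\mu;\delta(y)}\dagger$, $\dfrac{x\xrightarrow\surd\mu\ \ y\xrightarrow a\nu}{x;y\xrightarrow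 a\nu}$. - $x+y$: $\dfrac{x\xrightarrow a\mu}{x+y\xrightarrow a\mu}$, $\dfrac{y\xrightarrow a\nu}{x+y\xrightarrow a\nu}$. - $x+_py$: $\dfrac{x\xrightarrow a\mu\ \ y\not\xrightarrow a}{x+_py\xrightarrow a\mu}$, $\dfrac{x\not\xrightarrow a\ \ y\xrightarrow a\nu}{x+_py\xrightarrow a\nu}$, $\dfrac{x\xrightarrow a\mu\ \ y\xrightarrow a\nu}{x+_py\xrightarrow a\mu\oplus_p\nu}$. - All four parallel operators $\circ\in\{\mid,\ |||,\ |||_p,\ \parallel_B\}$ have the rule $\dfrac{x\xrightarrow\surd\mu\ \ y\xrightarrow\surd\nu}{x\circ y\xrightarrow\surd\delta(0)}$. In addition: $x\mid y$ has $\dfrac{x\xrightarrow a\mu\ \ y\xrightarrow a\nu}{x\mid y\xrightarrow a\mu\mid\nu}\dagger$; $x\,|||\,y$ has $\dfrac{x\xrightarrow a\mu}{x|||y\xrightarrow a\mu|||\delta(y)}\dagger$ and $\dfrac{y\xrightarrow a\nu}{x|||y\xrightarrow a\delta(x)|||\nu}\dagger$; $x\,|||_p\,y$ has $\dfrac{x\xrightarrow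 a\mu\ \ y\not\xrightarrow a}{x|||_py\xrightarrow a\mu|||_p\delta(y)}\dagger$, $\dfrac{x\not\xrightarrow a\ \ y\xrightarrow a\nu}{x|||_py\xrightarrow a\delta(x)|||_p\nu}\dagger$ and $\dfrac{x\xrightarrow a\mu\ \ y\xrightarrow a\nu}{x|||_py\xrightarrow a(\mu|||_p\delta(y))\oplus_p(\delta(x)|||_p\nu)}\dagger$; $x\parallel_By$ has the rule of $\mid$ for $a\in B\setminus\{\surd\}$ and the two rules of $|||$ for $a\notin B\cup\{\surd\}$ (with $\parallel_B$ in place of $\mid$ and $|||$). - Finite iteration $x^n$: $\dfrac{x\xrightarrow a\mu}{x^{n+1}\xrightarrow a\mu;\delta(x^n)}\dagger$, $\dfrac{x\xrightarrow\surd\mu}{x^{n+1}\xrightarrow\surd\mu}$, $x^0\xrightarrow\surd\delta(0)$, $\dfrac{x\xrightarrow\surd\mu\ \ x\xrightarrow a\nu}{x^n\xrightarrow a\nu;\delta(x^m)}\dagger\ (m<n)$. - Infinite iteration $x^\omega$: $\dfrac{x\xrightarrow a\mu}{x^\omega\xrightarrow a\mu;\delta(x^\omega)}\dagger$. - Nondeterministic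 Kleene star $x^*y$: $\dfrac{x\xrightarrow a\mu}{x^*y\xrightarrow a\mu;\delta(x^*y)}\dagger$, $\dfrac{y\xrightarrow a\nu}{x^*y\xrightarrow a\nu}$. - Probabilistic Kleene star $x^{*_p}y$: $\dfrac{x\xrightarrow a\mu\ \ y\xrightarrow a\nu}{x^{*_p}y\xrightarrow a\nu\oplus_p(\mu;\delta(x^{*_p}y))}\dagger$, $\dfrac{x\xrightarrow a\mu\ \ y\not\xrightarrow a}{x^{*_p}y\xrightarrow a\mu;\delta(x^{*_p}y)}\dagger$, $\dfrac{x\not\xrightarrow a\ \ y\xrightarrow a\nu}{x^{*_p}y\xrightarrow a\nu}\dagger$, $\dfrac{y\xrightarrow\surd\nu}{x^{*_p}y\xrightarrow\surd\nu}$. - Finite replication $!^nx$: $\dfrac{x\xrightarrow a\mu}{!^{n+1}x\xrightarrow a\mu|||\delta(!^nx)}\dagger$, $\dfrac{x\xrightarrow\surd\mu}{!^{n+1}x\xrightarrow\surd\mu}$, $!^0x\xrightarrow\surd\delta(0)$. - Infinite replication (bang) $!x$: $\dfrac{x\xrightarrow a\mu}{!x\xrightarrow a\mu|||\delta(!x)}\dagger$;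 probabilistic bang $!_px$: $\dfrac{x\xrightarrow a\mu}{!_px\xrightarrow a\mu\oplus_p(\mu|||\delta(!_px))}\dagger$. **Theorem.** Let $P=(\Sigma,A,R)$ be a PGSOS specification that is a disjoint extension of $P_{\mathrm{PA}^\circlearrowleft}$, i.e. it contains all operators and rules of $P_{\mathrm{PA}^\circlearrowleft}$ and no further rule for an operator of $P_{\mathrm{PA}^\circlearrowleft}$, and let $\lambda\in(0,1)$. Then the $\lambda$-bisimilarity metric $\mathbf d_\lambda$ on $T(\Sigma)$ exists, and infinite iteration, nondeterministic Kleene star, probabilistic Kleene star (for every $p\in(0,1)$) and infinite replication are Lipschitz continuous with respect to $\mathbf d_\lambda$ with Lipschitz factor $K=\frac1{1-\lambda}$; that is, for all $s,t,s_1,s_2,t_1,t_2\in T(\Sigma)$, $$\mathbf d_\lambda(s^\omega,t^\omega)\le\tfrac{1}{1-\lambda}\,\mathbf d_\lambda(s,t),\qquad \mathbf d_\lambda(!s,!t)\le\tfrac{1}{1-\lambda}\,\mathbf d_\lambda(s,t),$$ $$\mathbf d_\lambda(s_1{}^{*}s_2,t_1{}^{*}t_2)\le\tfrac{1}{1-\lambda}\big(\mathbf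 d_\lambda(s_1,t_1)+\mathbf d_\lambda(s_2,t_2)\big),\qquad \mathbf d_\lambda(s_1{}^{*_p}s_2,t_1{}^{*_p}t_2)\le\tfrac{1}{1-\lambda}\big(\mathbf d_\lambda(s_1,t_1)+\mathbf d_\lambda(s_2,t_2)\big).$$ -/

import Mathlib

noncomputable section

namespace ProcCalc

universe u v w x

/-! ### Signatures, terms, distribution terms -/

/-- A signature: `S n` is the type of operators of rank `n`. -/
abbrev Signature := ℕ → Type v

/-- State terms over `S` with state variables in `V`. -/
inductive Term (S : Signature.{v}) (V : Type w) : Type (max v w)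
  | var (x : V) : Term S V
  | op {n : ℕ} (f : S n) (ts : Fin n → Term S V) : Term S V

/-- Closed state terms, also called processes. -/
abbrev Proc (S : Signature.{v}) : Type v := Term S Empty

/-- Substitution of terms for the state variables. -/
def Term.subst {S : Signature.{v}} {V : Type w} {W : Type x} (σ : V → Term S W) :
    Term S V → Term S W
  | .var x => σ x
  | .op f ts => .op f (fun i => (ts i).subst σ)

/-- Renaming of the operators along a rank-preserving map of signatures. -/
def Term.mapSig {S S' : Signature} (ι : ∀ n, S n → S' n) {V : Type w} : Term S V → Term S' V
  | .var x => .var x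
  | .op f ts => .op (ι _ f) (fun i => (ts i).mapSig ι)

/-- Distribution terms over `S` with state variables in `V` and distribution variables in `D`.
A weight `PMF I` has countable support, so `mix` is exactly the countable convex combination. -/
inductive DTerm (S : Signature.{v}) (V : Type w) (D : Type x) : Type (max v w x 1)
  | var (μ : D) : DTerm S V D
  | dirac (t : Term S V) : DTerm S V D
  | mix {I : Type} (p : PMF I) (θ : I → DTerm S V D) : DTerm S V D
  | op {n : ℕ} (f : S n) (θ : Fin n → DTerm S V D) : DTerm S V D

/-- Renaming of the operators in a distribution term. -/
def DTerm.mapSig {S S' : Signature} (ι : ∀ n, S n → S' n) {V : Type w} {D : Type x} :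
    DTerm S V D → DTerm S' V D
  | .var μ => .var μ
  | .dirac t => .dirac (t.mapSig ι)
  | .mix p θ => .mix p (fun i => (θ i).mapSig ι)
  | .op f θ => .op (ι _ f) (fun i => (θ i).mapSig ι)

/-- The product of finitely many discrete distributions. -/
def piPMF {α : Type w} : {n : ℕ} → (Fin n → PMF α) → PMF (Fin n → α)
  | 0, _ => PMF.pure Fin.elim0
  | _ + 1, π => (π 0).bind fun x => (piPMF (Fin.tail π)).map (Fin.cons x)

theorem piPMF_apply {α : Type w} {n : ℕ} (π : Fin n → PMF α) (y : Fin n → α) :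
    piPMF π y = ∏ i, π i (y i) := by
  classical
  induction n with
  | zero =>
    have : y = Fin.elim0 := Subsingleton.elim _ _
    simp [piPMF, this]
  | succ n ih =>
    rw [Fin.prod_univ_succ]
    simp only [piPMF, PMF.bind_apply, PMF.map_apply]
    rw [tsum_eq_single (y 0)]
    · rw [tsum_eq_single (Fin.tail y)]
      · simp [ih, Fin.tail]
      · intro z hz
        rw [if_neg]
        intro h
        exact hz (by rw [h, Fin.tail_cons])
    · intro z hz
      rw [mul_eq_zero]
      right
      rw [ENNReal.tsum_eq_zero]
      intro w
      rw [if_neg]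
      intro h
      exact hz (by rw [h, Fin.cons_zero])

/-- The distribution denoted by a distribution term when the state variables stand for processes
and the distribution variables for distributions; `f(π₁, …, πₙ)` is the product distribution
transported along `f`. -/
def DTerm.eval {S : Signature.{v}} {V : Type w} {D : Type x} (σ : V → Proc S)
    (ρ : D → PMF (Proc S)) : DTerm S V D → PMF (Proc S)
  | .var μ => ρ μ
  | .dirac t => PMF.pure (t.subst σ)
  | .mix p θ => p.bind fun i => (θ i).eval σ ρ
  | .op f θ => (piPMF fun i => (θ i).eval σ ρ).map (Term.op f)

/-! ### PGSOS specifications -/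

/-- A PGSOS rule without its source operator `f` (of rank `n`) and its label. The source variables
are `x_i`, `i : Fin n`. The positive premises are `x_i -b-> μ_k` with `(i, b) = pos k` for
`k : Fin numPos`, so the distribution variables are pairwise distinct; the negative premises say
that `x_i` has no `b`-transition, for `(i, b) ∈ neg`. The target has no other variables. -/
structure Rule (S : Signature.{v}) (A : Type u) (n : ℕ) where
  numPos : ℕ
  pos : Fin numPos → Fin n × A
  neg : Finset (Fin n × A)
  target : DTerm S (Fin n) (Fin numPos)

/-- Renaming of the operators in a rule. -/
def Rule.mapSig {S S' : Signature} (ι : ∀ n, S n → S' n) {A : Type u} {n : ℕ}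
    (r : Rule S A n) : Rule S' A n where
  numPos := r.numPos
  pos := r.pos
  neg := r.neg
  target := r.target.mapSig ι

/-- A probabilistic transition system specification in PGSOS format: `rules f a` is the finite set
of the rules with source operator `f` and label `a`. -/
structure PTSS (S : Signature.{v}) (A : Type u) where
  rules : {n : ℕ} → S n → A → Set (Rule S A n)
  finite_rules : ∀ {n : ℕ} (f : S n) (a : A), (rules f a).Finite

/-- `P'` is a disjoint extension of `P`: the signature of `P` is contained in that of `P'`, all
rules of `P` are rules of `P'`, and `P'` has no other rule for an operator of `P`. -/
structure IsDisjointExtension {S S' : Signature} {A : Type u} (ι : ∀ n, S n → S' n)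
    (P : PTSS S A) (P' : PTSS S' A) : Prop where
  injective : ∀ n, Function.Injective (ι n)
  rules_eq : ∀ {n : ℕ} (f : S n) (a : A), P'.rules (ι n f) a = Rule.mapSig ι '' P.rules f a

/-- The transition relation of a probabilistic transition system on the processes over `S`. -/
abbrev PTS (S : Signature.{v}) (A : Type u) := Proc S → A → PMF (Proc S) → Prop

/-- `M` contains exactly the transitions `t -a-> π` that some rule of `P` justifies in `M`. -/
def IsSupportedModel {S : Signature.{v}} {A : Type u} (P : PTSS S A) (M : PTS S A) : Prop :=
  ∀ (t : Proc S) (a : A) (π : PMF (Proc S)), M t a π ↔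
    ∃ (n : ℕ) (f : S n) (σ : Fin n → Proc S), ∃ r ∈ P.rules f a,
      ∃ ρ : Fin r.numPos → PMF (Proc S),
        (∀ k, M (σ (r.pos k).1) (r.pos k).2 (ρ k)) ∧
        (∀ q ∈ r.neg, ∀ π', ¬ M (σ q.1) q.2 π') ∧
        t = .op f σ ∧ π = r.target.eval σ ρ

/-- The induced model of `P`, by recursion on the source term; it is the unique supported model,
see `isSupportedModel_iff`. -/
def PTSS.model {S : Signature.{v}} {A : Type u} (P : PTSS S A) : PTS S A
  | .var x => x.elim
  | .op f ts => fun a π => ∃ r ∈ P.rules f a, ∃ ρ : Fin r.numPos → PMF (Proc S),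
      (∀ k, P.model (ts (r.pos k).1) (r.pos k).2 (ρ k)) ∧
      (∀ q ∈ r.neg, ∀ π', ¬ P.model (ts q.1) q.2 π') ∧
      π = r.target.eval ts ρ

theorem isSupportedModel_iff {S : Signature.{v}} {A : Type u} (P : PTSS S A) (M : PTS S A) :
    IsSupportedModel P M ↔ M = P.model := by
  constructor
  · intro h
    funext t
    induction t with
    | var x => exact x.elim
    | op f ts ih =>
      funext a π
      apply propext
      rw [h]
      simp only [PTSS.model]
      constructor
      · rintro ⟨n, g, σ, r, hr, ρ, hp, hn, ht, hπ⟩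
        cases ht
        exact ⟨r, hr, ρ, fun k => by rw [← ih]; exact hp k,
          fun q hq π' => by rw [← ih]; exact hn q hq π', hπ⟩
      · rintro ⟨r, hr, ρ, hp, hn, hπ⟩
        exact ⟨_, f, ts, r, hr, ρ, fun k => by rw [ih]; exact hp k,
          fun q hq π' => by rw [ih]; exact hn q hq π', rfl, hπ⟩
  · rintro rfl t a π
    constructor
    · cases t with
      | var x => exact x.elim
      | op f ts =>
        intro h
        simp only [PTSS.model] at h
        obtain ⟨r, hr, ρ, hp, hn, hπ⟩ := h
        exact ⟨_, f, ts, r, hr, ρ, hp, hn, rfl, hπ⟩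
    · rintro ⟨n, f, σ, r, hr, ρ, hp, hn, rfl, hπ⟩
      simp only [PTSS.model]
      exact ⟨r, hr, ρ, hp, hn, hπ⟩

/-! ### The bisimilarity metric -/

/-- A `1`-bounded pseudometric. -/
structure IsPseudometric {T : Type w} (d : T → T → ℝ) : Prop where
  nonneg : ∀ t t', 0 ≤ d t t'
  le_one : ∀ t t', d t t' ≤ 1
  self : ∀ t, d t t = 0
  symm : ∀ t t', d t t' = d t' t
  triangle : ∀ t t' t'', d t t' ≤ d t t'' + d t'' t'

/-- The matchings of two distributions. -/
def matchings {T : Type w} (π π' : PMF T) : Set (PMF (T × T)) :=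
  {ω | ω.map Prod.fst = π ∧ ω.map Prod.snd = π'}

/-- The Kantorovich lifting of `d`. -/
def kantorovich {T : Type w} (d : T → T → ℝ) (π π' : PMF T) : ℝ :=
  sInf ((fun ω : PMF (T × T) => ∑' q : T × T, d q.1 q.2 * (ω q).toReal) '' matchings π π')

/-- `d` is a `lam`-bisimulation metric on the transition system `M`. -/
def IsBisimulationMetric {S : Signature.{v}} {A : Type u} (M : PTS S A) (lam : ℝ)
    (d : Proc S → Proc S → ℝ) : Prop :=
  IsPseudometric d ∧
    ∀ t t', d t t' < 1 → ∀ a π, M t a π → ∃ π', M t' a π' ∧ lam * kantorovich d π π' ≤ d t t'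

/-- The `lam`-bisimilarity metric, the smallest `lam`-bisimulation metric, given as the pointwise
infimum of all `lam`-bisimulation metrics. -/
def bisimilarityMetric {S : Signature.{v}} {A : Type u} (M : PTS S A) (lam : ℝ)
    (s t : Proc S) : ℝ :=
  sInf {c | ∃ d, IsBisimulationMetric M lam d ∧ d s t = c}

/-- The operator `f` is `K`-Lipschitz continuous with respect to `d`. -/
def IsLipschitzOp {S : Signature.{v}} (d : Proc S → Proc S → ℝ) (K : ℝ) {n : ℕ} (f : S n) :
    Prop :=
  0 ≤ K ∧ ∀ s t : Fin n → Proc S, d (.op f s) (.op f t) ≤ K * ∑ i, d (s i) (t i)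

/-! ### The probabilistic process algebra with recursion -/

/-- The operators of the process algebra over the actions `A`. -/
inductive PAOp (A : Type u) : Signature.{u}
  /-- the inactive process `0` -/
  | nil : PAOp A 0
  /-- the skip process `ε` -/
  | skip : PAOp A 0
  /-- probabilistic prefix `a.([p₁]_ ⊕ ⋯ ⊕ [pₙ]_)` with all `pᵢ > 0` -/
  | pre {n : ℕ} (a : A) (p : PMF (Fin n)) (hp : ∀ i, p i ≠ 0) : PAOp A n
  /-- sequential composition `x ; y` -/
  | seq : PAOp A 2
  /-- alternative composition `x + y` -/
  | alt : PAOp A 2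
  /-- probabilistic alternative composition `x +_p y` -/
  | altP (p : Set.Ioo (0 : ℝ) 1) : PAOp A 2
  /-- synchronous parallel composition `x | y` -/
  | sync : PAOp A 2
  /-- asynchronous parallel composition `x ||| y` -/
  | async : PAOp A 2
  /-- probabilistic parallel composition `x |||_p y` -/
  | asyncP (p : Set.Ioo (0 : ℝ) 1) : PAOp A 2
  /-- CSP-like parallel composition with synchronization on the actions in `B` -/
  | par (B : Set A) : PAOp A 2
  /-- finite iteration `x^n` -/
  | iter (n : ℕ) : PAOp A 1
  /-- infinite iteration `x^ω` -/
  | omega : PAOp A 1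
  /-- nondeterministic Kleene star `x^* y` -/
  | star : PAOp A 2
  /-- probabilistic Kleene star `x^{*_p} y` -/
  | starP (p : Set.Ioo (0 : ℝ) 1) : PAOp A 2
  /-- finite replication `!^n x` -/
  | repl (n : ℕ) : PAOp A 1
  /-- infinite replication (bang) `! x` -/
  | bang : PAOp A 1
  /-- probabilistic bang `!_p x` -/
  | bangP (p : Set.Ioo (0 : ℝ) 1) : PAOp A 1

/-- The distribution on `Bool` with weight `p` on `true` and `1 - p` on `false`. -/
def coin (p : Set.Ioo (0 : ℝ) 1) : PMF Bool :=
  PMF.ofFintype (fun b => bif b then ENNReal.ofReal p else ENNReal.ofReal (1 - p)) (by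
    have h0 := p.2.1
    have h1 := p.2.2
    rw [Fintype.sum_bool, cond_true, cond_false, ← ENNReal.ofReal_add h0.le (by linarith)]
    simp)

section DistributionTerms

variable {A : Type u} {V : Type w} {D : Type x}

/-- The distribution term `θ₁ ⊕_p θ₂`. -/
def dMix (p : Set.Ioo (0 : ℝ) 1) (θ₁ θ₂ : DTerm (PAOp A) V D) : DTerm (PAOp A) V D :=
  .mix (coin p) (fun b => bif b then θ₁ else θ₂)

/-- The distribution term `f(θ)`. -/
def d1 (f : PAOp A 1) (θ : DTerm (PAOp A) V D) : DTerm (PAOp A) V D := .op f ![θ]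

/-- The distribution term `f(θ₁, θ₂)`. -/
def d2 (f : PAOp A 2) (θ₁ θ₂ : DTerm (PAOp A) V D) : DTerm (PAOp A) V D := .op f ![θ₁, θ₂]

/-- The distribution term `δ(0)`. -/
def dNil : DTerm (PAOp A) V D := .dirac (.op .nil ![])

/-- The distribution term `δ(x)` for a state variable `x`. -/
def dVar (i : V) : DTerm (PAOp A) V D := .dirac (.var i)

/-- The distribution term `δ(f(x))` for a state variable `x`. -/
def dOp1 (f : PAOp A 1) (i : V) : DTerm (PAOp A) V D := .dirac (.op f ![.var i])

/-- The distribution term `δ(f(x, y))` for state variables `x`, `y`. -/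
def dOp2 (f : PAOp A 2) (i j : V) : DTerm (PAOp A) V D := .dirac (.op f ![.var i, .var j])

end DistributionTerms

/-- The rules with source operator `f` and label `a`; `tick` is the action `√` of successful
termination. The state variables are `x = 0` and `y = 1`, and `.var k` is the distribution variable
of the `k`-th positive premise. -/
def paRules {A : Type u} (tick : A) : {n : ℕ} → PAOp A n → A → Set (Rule (PAOp A) A n)
  | _, .nil, _ => ∅
  | _, .skip, a => {r | a = tick ∧ r = ⟨0, ![], ∅, dNil⟩}
  | _, .pre b p _, a => {r | a = b ∧ r = ⟨0, ![], ∅, .mix p (fun i => dVar i)⟩}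
  | _, .seq, a =>
      {r | a ≠ tick ∧ r = ⟨1, ![(0, a)], ∅, d2 .seq (.var 0) (dVar 1)⟩} ∪
      {r | r = ⟨2, ![(0, tick), (1, a)], ∅, .var 1⟩}
  | _, .alt, a =>
      {r | r = ⟨1, ![(0, a)], ∅, .var 0⟩} ∪
      {r | r = ⟨1, ![(1, a)], ∅, .var 0⟩}
  | _, .altP p, a =>
      {r | r = ⟨1, ![(0, a)], {(1, a)}, .var 0⟩} ∪
      {r | r = ⟨1, ![(1, a)], {(0, a)}, .var 0⟩} ∪
      {r | r = ⟨2, ![(0, a), (1, a)], ∅, dMix p (.var 0) (.var 1)⟩}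
  | _, .sync, a =>
      {r | a ≠ tick ∧ r = ⟨2, ![(0, a), (1, a)], ∅, d2 .sync (.var 0) (.var 1)⟩} ∪
      {r | a = tick ∧ r = ⟨2, ![(0, tick), (1, tick)], ∅, dNil⟩}
  | _, .async, a =>
      {r | a ≠ tick ∧ r = ⟨1, ![(0, a)], ∅, d2 .async (.var 0) (dVar 1)⟩} ∪
      {r | a ≠ tick ∧ r = ⟨1, ![(1, a)], ∅, d2 .async (dVar 0) (.var 0)⟩} ∪
      {r | a = tick ∧ r = ⟨2, ![(0, tick), (1, tick)], ∅, dNil⟩}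
  | _, .asyncP p, a =>
      {r | a ≠ tick ∧ r = ⟨1, ![(0, a)], {(1, a)}, d2 (.asyncP p) (.var 0) (dVar 1)⟩} ∪
      {r | a ≠ tick ∧ r = ⟨1, ![(1, a)], {(0, a)}, d2 (.asyncP p) (dVar 0) (.var 0)⟩} ∪
      {r | a ≠ tick ∧ r = ⟨2, ![(0, a), (1, a)], ∅,
        dMix p (d2 (.asyncP p) (.var 0) (dVar 1)) (d2 (.asyncP p) (dVar 0) (.var 1))⟩} ∪
      {r | a = tick ∧ r = ⟨2, ![(0, tick), (1, tick)], ∅, dNil⟩}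
  | _, .par B, a =>
      {r | (a ∈ B ∧ a ≠ tick) ∧ r = ⟨2, ![(0, a), (1, a)], ∅, d2 (.par B) (.var 0) (.var 1)⟩} ∪
      {r | a = tick ∧ r = ⟨2, ![(0, tick), (1, tick)], ∅, dNil⟩} ∪
      {r | (a ∉ B ∧ a ≠ tick) ∧ r = ⟨1, ![(0, a)], ∅, d2 (.par B) (.var 0) (dVar 1)⟩} ∪
      {r | (a ∉ B ∧ a ≠ tick) ∧ r = ⟨1, ![(1, a)], ∅, d2 (.par B) (dVar 0) (.var 0)⟩}
  | _, .iter n, a =>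
      {r | ∃ m < n, (a ≠ tick ∧ n = m + 1) ∧
        r = ⟨1, ![(0, a)], ∅, d2 .seq (.var 0) (dOp1 (.iter m) 0)⟩} ∪
      {r | (a = tick ∧ 0 < n) ∧ r = ⟨1, ![(0, tick)], ∅, .var 0⟩} ∪
      {r | (a = tick ∧ n = 0) ∧ r = ⟨0, ![], ∅, dNil⟩} ∪
      {r | ∃ m < n, a ≠ tick ∧
        r = ⟨2, ![(0, tick), (0, a)], ∅, d2 .seq (.var 1) (dOp1 (.iter m) 0)⟩}
  | _, .omega, a =>
      {r | a ≠ tick ∧ r = ⟨1, ![(0, a)], ∅, d2 .seq (.var 0) (dOp1 .omega 0)⟩}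
  | _, .star, a =>
      {r | a ≠ tick ∧ r = ⟨1, ![(0, a)], ∅, d2 .seq (.var 0) (dOp2 .star 0 1)⟩} ∪
      {r | r = ⟨1, ![(1, a)], ∅, .var 0⟩}
  | _, .starP p, a =>
      {r | a ≠ tick ∧ r = ⟨2, ![(0, a), (1, a)], ∅,
        dMix p (.var 1) (d2 .seq (.var 0) (dOp2 (.starP p) 0 1))⟩} ∪
      {r | a ≠ tick ∧ r = ⟨1, ![(0, a)], {(1, a)}, d2 .seq (.var 0) (dOp2 (.starP p) 0 1)⟩} ∪
      {r | a ≠ tick ∧ r = ⟨1, ![(1, a)], {(0, a)}, .var 0⟩} ∪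
      {r | a = tick ∧ r = ⟨1, ![(1, tick)], ∅, .var 0⟩}
  | _, .repl n, a =>
      {r | ∃ m < n, (a ≠ tick ∧ n = m + 1) ∧
        r = ⟨1, ![(0, a)], ∅, d2 .async (.var 0) (dOp1 (.repl m) 0)⟩} ∪
      {r | (a = tick ∧ 0 < n) ∧ r = ⟨1, ![(0, tick)], ∅, .var 0⟩} ∪
      {r | (a = tick ∧ n = 0) ∧ r = ⟨0, ![], ∅, dNil⟩}
  | _, .bang, a =>
      {r | a ≠ tick ∧ r = ⟨1, ![(0, a)], ∅, d2 .async (.var 0) (dOp1 .bang 0)⟩}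
  | _, .bangP p, a =>
      {r | a ≠ tick ∧ r = ⟨1, ![(0, a)], ∅,
        dMix p (.var 0) (d2 .async (.var 0) (dOp1 (.bangP p) 0))⟩}

theorem finite_and_eq {α : Type w} (p : Prop) (c : α) : {r | p ∧ r = c}.Finite :=
  (Set.finite_singleton c).subset fun _ h => h.2

theorem finite_lt_and_eq {α : Type w} (n : ℕ) (p : ℕ → Prop) (c : ℕ → α) :
    {r | ∃ m < n, p m ∧ r = c m}.Finite :=
  ((Set.finite_Iio n).image c).subset fun _ ⟨m, hm, _, h⟩ => ⟨m, hm, h.symm⟩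

theorem finite_paRules {A : Type u} (tick : A) {n : ℕ} (f : PAOp A n) (a : A) :
    (paRules tick f a).Finite := by
  cases f <;> simp only [paRules]
  case nil => exact Set.finite_empty
  all_goals
    repeat' apply Set.Finite.union
    all_goals first
      | exact finite_and_eq _ _
      | exact Set.finite_singleton _
      | exact finite_lt_and_eq _ _ _

/-- The specification of the process algebra with recursion. -/
def paSpec {A : Type u} (tick : A) : PTSS (PAOp A) A where
  rules := paRules tick
  finite_rules := finite_paRules tick

end ProcCalc

end

open ProcCalc

/-!
On functions with values in `[0, ∞]` the bisimulation conditions become a monotone functional,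
whose least fixed point `D` is the bisimilarity metric; fixed point induction shows that `D` is a
pseudometric, so the least bisimulation metric exists. Another fixed point induction shows that
`;` and `|||` do not expand `D`. Now let `f` be one of the four recursive operators. A transition
of `f(σ)` is a transition of some `σ i`, possibly followed by `_ ; f(σ)` or `_ ||| f(σ)`. Answering
it by the corresponding transition of `f(τ)` costs at most `∑ i, D (σ i) (τ i)` for that first
step, and the recursive occurrence of `f` costs its distance discounted by `l`. Hence
`D (f(σ)) (f(τ)) ≤ ∑ i, D (σ i) (τ i) + l * D (f(σ)) (f(τ))`, and solving for `D (f(σ)) (f(τ))`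
yields the factor `1 / (1 - l)`.
-/

namespace ProcCalc

open scoped ENNReal

/-! ### Means and couplings of discrete distributions -/

/-- The mean of a nonnegative function with respect to a discrete distribution. -/
noncomputable def mean {α : Type*} (p : PMF α) (g : α → ℝ≥0∞) : ℝ≥0∞ := ∑' a, p a * g a

section Mean

variable {α β : Type*} (p : PMF α)

theorem mean_mono {g h : α → ℝ≥0∞} (hgh : ∀ a, g a ≤ h a) : mean p g ≤ mean p h :=
  ENNReal.tsum_le_tsum fun a => mul_le_mul_right (hgh a) (p a)

theorem mean_add (g h : α → ℝ≥0∞) : (mean p fun a => g a + h a) = mean p g + mean p h := by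
  simp only [mean, mul_add, ENNReal.tsum_add]

theorem mean_const_mul (c : ℝ≥0∞) (g : α → ℝ≥0∞) : (mean p fun a => c * g a) = c * mean p g := by
  simp only [mean, mul_left_comm _ c, ENNReal.tsum_mul_left]

theorem mean_const (c : ℝ≥0∞) : (mean p fun _ => c) = c := by
  rw [mean, ENNReal.tsum_mul_right, p.tsum_coe, one_mul]

theorem mean_add_const (g : α → ℝ≥0∞) (c : ℝ≥0∞) : (mean p fun a => g a + c) = mean p g + c := by
  rw [mean_add, mean_const]

theorem mean_pure (a : α) (g : α → ℝ≥0∞) : mean (PMF.pure a) g = g a := by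
  rw [mean, tsum_eq_single a fun b hb => by rw [PMF.pure_apply_of_ne a b hb, zero_mul],
    PMF.pure_apply_self, one_mul]

theorem mean_bind (k : α → PMF β) (g : β → ℝ≥0∞) :
    mean (p.bind k) g = mean p fun a => mean (k a) g := by
  simp only [mean, PMF.bind_apply, ← ENNReal.tsum_mul_right, ← ENNReal.tsum_mul_left, mul_assoc]
  exact ENNReal.tsum_comm

theorem mean_map (f : α → β) (g : β → ℝ≥0∞) : mean (p.map f) g = mean p fun a => g (f a) := by
  simp only [PMF.map, mean_bind, Function.comp_apply, mean_pure]

end Mean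

section Disintegration

variable {α β : Type*}

theorem map_fst_apply (ω : PMF (α × β)) (a : α) : ω.map Prod.fst a = ∑' b, ω (a, b) := by
  classical
  rw [PMF.map_apply, ENNReal.tsum_prod', tsum_eq_single a]
  · simp only [if_true]
  · intro a' ha
    simp only [if_neg ha.symm, tsum_zero]

theorem bind_map_mk_apply (p : PMF α) (k : α → PMF β) (a : α) (b : β) :
    (p.bind fun a => (k a).map (Prod.mk a)) (a, b) = p a * k a b := by
  classical
  rw [PMF.bind_apply, tsum_eq_single a]
  · rw [PMF.map_apply, tsum_eq_single b]
    · simp only [if_true]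
    · intro b' hb
      exact if_neg fun h => hb (congrArg Prod.snd h).symm
  · intro a' ha
    rw [PMF.map_apply, mul_eq_zero, ENNReal.tsum_eq_zero]
    exact Or.inr fun b' => if_neg fun h => ha (congrArg Prod.fst h).symm

theorem exists_conditional (ω : PMF (α × β)) (a : α) :
    ∃ k : PMF β, ∀ b, ω (a, b) = ω.map Prod.fst a * k b := by
  by_cases h0 : ω.map Prod.fst a = 0
  · obtain ⟨⟨-, b₀⟩, -⟩ := ω.support_nonempty
    have hω : ∀ b, ω (a, b) = 0 := ENNReal.tsum_eq_zero.1 (map_fst_apply ω a ▸ h0)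
    exact ⟨PMF.pure b₀, fun b => by rw [h0, zero_mul, hω]⟩
  · have htop := (ω.map Prod.fst).apply_ne_top a
    refine ⟨PMF.normalize (fun b => ω (a, b)) (map_fst_apply ω a ▸ h0)
      (map_fst_apply ω a ▸ htop), fun b => ?_⟩
    rw [PMF.normalize_apply, ← map_fst_apply, mul_left_comm, ENNReal.mul_inv_cancel h0 htop,
      mul_one]

theorem exists_disintegration (ω : PMF (α × β)) :
    ∃ k : α → PMF β, ω = (ω.map Prod.fst).bind fun a => (k a).map (Prod.mk a) := by
  choose k hk using exists_conditional ω
  exact ⟨k, PMF.ext fun ⟨a, b⟩ => by rw [bind_map_mk_apply, hk]⟩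

end Disintegration

section Matchings

variable {T I : Type*} {π π' ν : PMF T} {ω : PMF (T × T)}

theorem map_prodMk_mem_matchings (p : PMF I) (f g : I → T) :
    p.map (fun i => (f i, g i)) ∈ matchings (p.map f) (p.map g) := by
  constructor <;> rw [PMF.map_comp] <;> rfl

theorem bind_mem_matchings (p : PMF I) {f g : I → PMF T} {ω : I → PMF (T × T)}
    (h : ∀ i, ω i ∈ matchings (f i) (g i)) : p.bind ω ∈ matchings (p.bind f) (p.bind g) := by
  constructor <;> rw [PMF.map_bind]
  · exact congrArg p.bind (funext fun i => (h i).1)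
  · exact congrArg p.bind (funext fun i => (h i).2)

theorem map_swap_mem_matchings (h : ω ∈ matchings π π') : ω.map Prod.swap ∈ matchings π' π := by
  constructor <;> rw [PMF.map_comp]
  exacts [h.2, h.1]

theorem bind_map_mk_mem_matchings (π π' : PMF T) :
    (π.bind fun s => π'.map (Prod.mk s)) ∈ matchings π π' := by
  constructor <;> simp only [PMF.map_bind, PMF.map_comp]
  · exact (congrArg π.bind (funext fun s => PMF.map_const π' s)).trans (PMF.bind_pure π)
  · exact (congrArg π.bind (funext fun _ => PMF.map_id π')).trans (PMF.bind_const π π')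

theorem exists_kernel_of_mem_matchings (h : ω ∈ matchings ν π) :
    ∃ k : T → PMF T, ν.bind k = π ∧ ω = ν.bind fun u => (k u).map (Prod.mk u) := by
  obtain ⟨rfl, rfl⟩ := h
  obtain ⟨k, hk⟩ := exists_disintegration ω
  refine ⟨k, ?_, hk⟩
  conv_rhs => rw [hk, PMF.map_bind]
  refine congrArg _ (funext fun u => ?_)
  rw [PMF.map_comp]
  exact (PMF.map_id (k u)).symm

end Matchings

/-! ### The optimal transport cost -/

/-- The Kantorovich lifting of a cost with values in `[0, ∞]`; for costs bounded by `1` it is the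
real-valued `kantorovich`, see `ofReal_kantorovich`. -/
noncomputable def transportCost {T : Type*} (e : T → T → ℝ≥0∞) (π π' : PMF T) : ℝ≥0∞ :=
  ⨅ ω ∈ matchings π π', mean ω fun q => e q.1 q.2

/-- A pseudometric with values in `[0, ∞]`, as a property of a function. -/
structure IsPseudoEMetric {T : Type*} (e : T → T → ℝ≥0∞) : Prop where
  self : ∀ t, e t t = 0
  comm : ∀ s t, e s t = e t s
  triangle : ∀ s u t, e s t ≤ e s u + e u t

section TransportCost

variable {T I : Type*} {e e' e₁ e₂ : T → T → ℝ≥0∞} {π π' : PMF T}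

theorem transportCost_le {ω : PMF (T × T)} (hω : ω ∈ matchings π π') :
    transportCost e π π' ≤ mean ω fun q => e q.1 q.2 :=
  iInf₂_le ω hω

theorem exists_matching_le_add (e : T → T → ℝ≥0∞) (π π' : PMF T) {ε : ℝ≥0∞} (hε : ε ≠ 0) :
    ∃ ω ∈ matchings π π', (mean ω fun q => e q.1 q.2) ≤ transportCost e π π' + ε := by
  rcases eq_or_ne (transportCost e π π') ∞ with htop | htop
  · exact ⟨_, bind_map_mk_mem_matchings π π', by rw [htop, top_add]; exact le_top⟩
  · obtain ⟨ω, hω⟩ := iInf_lt_iff.1 (ENNReal.lt_add_right htop hε)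
    obtain ⟨hmem, hlt⟩ := iInf_lt_iff.1 hω
    exact ⟨ω, hmem, hlt.le⟩

theorem transportCost_mono (h : e ≤ e') (π π' : PMF T) :
    transportCost e π π' ≤ transportCost e' π π' :=
  iInf₂_mono fun ω _ => mean_mono ω fun q => h q.1 q.2

theorem transportCost_le_one (h : ∀ s t, e s t ≤ 1) (π π' : PMF T) : transportCost e π π' ≤ 1 :=
  (transportCost_le (bind_map_mk_mem_matchings π π')).trans
    ((mean_mono _ fun q : T × T => h q.1 q.2).trans (mean_const _ 1).le)

theorem transportCost_map_le {g h : T → T} {c : ℝ≥0∞} (hc : ∀ s t, e (g s) (h t) ≤ e' s t + c)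
    (π π' : PMF T) : transportCost e (π.map g) (π'.map h) ≤ transportCost e' π π' + c := by
  simp only [transportCost.eq_def e', ENNReal.iInf_add]
  refine le_iInf₂ ?_
  rintro ω ⟨rfl, rfl⟩
  rw [PMF.map_comp, PMF.map_comp]
  calc transportCost e (ω.map (g ∘ Prod.fst)) (ω.map (h ∘ Prod.snd))
      ≤ mean (ω.map fun q => (g q.1, h q.2)) fun q => e q.1 q.2 :=
        transportCost_le (map_prodMk_mem_matchings ω (g ∘ Prod.fst) (h ∘ Prod.snd))
    _ = mean ω fun q => e (g q.1) (h q.2) := mean_map ω _ _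
    _ ≤ mean ω fun q => e' q.1 q.2 + c := mean_mono ω fun q => hc q.1 q.2
    _ = (mean ω fun q => e' q.1 q.2) + c := mean_add_const ω _ c

theorem transportCost_bind_le (p : PMF I) (f g : I → PMF T) :
    transportCost e (p.bind f) (p.bind g) ≤ mean p fun i => transportCost e (f i) (g i) := by
  refine ENNReal.le_of_forall_pos_le_add fun ε hε _ => ?_
  choose ω hω hle using fun i =>
    exists_matching_le_add e (f i) (g i) (ENNReal.coe_ne_zero.2 hε.ne')
  calc transportCost e (p.bind f) (p.bind g)
      ≤ mean (p.bind ω) fun q => e q.1 q.2 := transportCost_le (bind_mem_matchings p hω)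
    _ = mean p fun i => mean (ω i) fun q => e q.1 q.2 := mean_bind p ω _
    _ ≤ mean p fun i => transportCost e (f i) (g i) + ε := mean_mono p hle
    _ = (mean p fun i => transportCost e (f i) (g i)) + ε := mean_add_const p _ _

theorem transportCost_self (h : ∀ t, e t t = 0) (π : PMF T) : transportCost e π π = 0 := by
  have hω := map_prodMk_mem_matchings π id id
  rw [PMF.map_id] at hω
  refine nonpos_iff_eq_zero.1 ((transportCost_le hω).trans ?_)
  simp only [mean_map, id_eq, h, mean_const, le_refl]

theorem transportCost_comm (h : ∀ s t, e s t = e t s) (π π' : PMF T) :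
    transportCost e π π' = transportCost e π' π := by
  have hle (π π' : PMF T) : transportCost e π π' ≤ transportCost e π' π := by
    refine le_iInf₂ fun ω hω => (transportCost_le (map_swap_mem_matchings hω)).trans ?_
    rw [mean_map]
    exact mean_mono ω fun q => (h q.2 q.1).le
  exact le_antisymm (hle π π') (hle π' π)

/-- Matchings of `ν` with `π` and of `ν` with `π'` are glued by choosing the two targets
independently given the point of `ν`. -/
theorem transportCost_le_add (h : ∀ u s t, e s t ≤ e₁ u s + e₂ u t) (ν π π' : PMF T) :
    transportCost e π π' ≤ transportCost e₁ ν π + transportCost e₂ ν π' := by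
  rw [transportCost.eq_def e₁, transportCost.eq_def e₂]
  simp only [ENNReal.iInf_add, ENNReal.add_iInf]
  refine le_iInf₂ fun ω₂ hω₂ => le_iInf₂ fun ω₁ hω₁ => ?_
  obtain ⟨k₁, rfl, rfl⟩ := exists_kernel_of_mem_matchings hω₁
  obtain ⟨k₂, rfl, rfl⟩ := exists_kernel_of_mem_matchings hω₂
  refine (transportCost_le (bind_mem_matchings ν fun u =>
    bind_map_mk_mem_matchings (k₁ u) (k₂ u))).trans ?_
  simp only [mean_bind, mean_map, ← mean_add]
  refine mean_mono ν fun u => ?_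
  calc (mean (k₁ u) fun s => mean (k₂ u) fun t => e s t)
      ≤ mean (k₁ u) fun s => mean (k₂ u) fun t => e₁ u s + e₂ u t :=
        mean_mono _ fun s => mean_mono _ fun t => h u s t
    _ = (mean (k₁ u) fun s => e₁ u s) + mean (k₂ u) fun t => e₂ u t := by
        simp only [mean_add, mean_const]

theorem IsPseudoEMetric.transportCost (he : IsPseudoEMetric e) :
    IsPseudoEMetric (transportCost e) where
  self := transportCost_self he.self
  comm := transportCost_comm he.comm
  triangle π ν π' := by
    rw [transportCost_comm he.comm π ν]
    exact transportCost_le_add (fun u s t => he.comm u s ▸ he.triangle s u t) ν π π'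

theorem IsPseudoEMetric.sSup {E : Set (T → T → ℝ≥0∞)} (hE : ∀ e ∈ E, IsPseudoEMetric e) :
    IsPseudoEMetric (sSup E) where
  self t := by
    simp only [sSup_apply, fun e : E => (hE e e.2).self t, iSup_apply, ENNReal.iSup_zero]
  comm s t := by
    simp only [sSup_apply, fun e : E => (hE e e.2).comm s t, iSup_apply]
  triangle s u t := by
    simp only [sSup_apply, iSup_apply]
    exact iSup_le fun e => ((hE e e.2).triangle s u t).trans
      (add_le_add (le_iSup (fun e : E => e.1 s u) e) (le_iSup (fun e : E => e.1 u t) e))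

theorem mul_transportCost_map_le {l c₁ c₂ : ℝ≥0∞} {g h : T → T}
    (hgh : ∀ s t, e (g s) (h t) ≤ e' s t + c₂) (hc : l * transportCost e' π π' ≤ c₁) :
    l * transportCost e (π.map g) (π'.map h) ≤ c₁ + l * c₂ :=
  calc l * transportCost e (π.map g) (π'.map h)
      ≤ l * (transportCost e' π π' + c₂) := mul_le_mul_right (transportCost_map_le hgh π π') l
    _ = l * transportCost e' π π' + l * c₂ := mul_add _ _ _
    _ ≤ c₁ + l * c₂ := add_le_add_left hc _

theorem mul_transportCost_bind_le {l c : ℝ≥0∞} (p : PMF I) {f g : I → PMF T}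
    (h : ∀ i, l * transportCost e (f i) (g i) ≤ c) :
    l * transportCost e (p.bind f) (p.bind g) ≤ c :=
  calc l * transportCost e (p.bind f) (p.bind g)
      ≤ l * mean p fun i => transportCost e (f i) (g i) :=
        mul_le_mul_right (transportCost_bind_le p f g) l
    _ = mean p fun i => l * transportCost e (f i) (g i) := (mean_const_mul p l _).symm
    _ ≤ c := (mean_mono p h).trans (mean_const p c).le

theorem ofReal_kantorovich {d : T → T → ℝ} (h0 : ∀ s t, 0 ≤ d s t) (h1 : ∀ s t, d s t ≤ 1)
    (π π' : PMF T) : ENNReal.ofReal (kantorovich d π π') =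
      transportCost (fun s t => ENNReal.ofReal (d s t)) π π' := by
  have hne (ω : PMF (T × T)) : (mean ω fun q => ENNReal.ofReal (d q.1 q.2)) ≠ ∞ := by
    refine (((mean_mono ω fun q => ?_).trans (mean_const ω 1).le).trans_lt
      ENNReal.one_lt_top).ne
    exact ENNReal.ofReal_le_one.2 (h1 q.1 q.2)
  have hmean (ω : PMF (T × T)) : ∑' q : T × T, d q.1 q.2 * (ω q).toReal =
      (mean ω fun q => ENNReal.ofReal (d q.1 q.2)).toReal := by
    rw [mean, ENNReal.tsum_toReal_eq fun q =>
      ENNReal.mul_ne_top (ω.apply_ne_top q) ENNReal.ofReal_ne_top]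
    simp only [ENNReal.toReal_mul, ENNReal.toReal_ofReal (h0 _ _), mul_comm]
  have hcost : transportCost (fun s t => ENNReal.ofReal (d s t)) π π' ≠ ∞ :=
    ((transportCost_le_one (fun s t => ENNReal.ofReal_le_one.2 (h1 s t)) π π').trans_lt
      ENNReal.one_lt_top).ne
  rw [← ENNReal.ofReal_toReal hcost, transportCost, ← sInf_image, ENNReal.toReal_sInf,
    Set.image_image, kantorovich]
  · simp only [hmean]
  · rintro _ ⟨ω, -, rfl⟩
    exact hne ω

end TransportCost

/-! ### The bisimulation functional and its least fixed point -/

section Bisimilarity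

variable {T A : Type*}

/-- `t` answers every transition of `s`, where the `l`-discounted transport cost between the
targets with respect to `e` is at most `c`. -/
def SimulatesWithin (M : T → A → PMF T → Prop) (l : ℝ≥0∞) (e : T → T → ℝ≥0∞) (c : ℝ≥0∞)
    (s t : T) : Prop :=
  ∀ a π, M s a π → ∃ π', M t a π' ∧ l * transportCost e π π' ≤ c

/-- Every state has finitely many transitions with a given label. -/
def ImageFinite (M : T → A → PMF T → Prop) : Prop := ∀ t a, {π | M t a π}.Finite

variable {M : T → A → PMF T → Prop} {l c c' : ℝ≥0∞} {e e' : T → T → ℝ≥0∞} {s t u : T}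

theorem SimulatesWithin.mono (h : SimulatesWithin M l e' c s t) (he : e ≤ e') (hc : c ≤ c') :
    SimulatesWithin M l e c' s t := fun a π hπ =>
  have ⟨π', hπ', hle⟩ := h a π hπ
  ⟨π', hπ', (mul_le_mul_right (transportCost_mono he π π') l).trans (hle.trans hc)⟩

theorem SimulatesWithin.refl (he : ∀ t, e t t = 0) (t : T) : SimulatesWithin M l e 0 t t :=
  fun _ π hπ => ⟨π, hπ, by rw [transportCost_self he, mul_zero]⟩

theorem SimulatesWithin.trans (he : IsPseudoEMetric e) (h : SimulatesWithin M l e c s u)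
    (h' : SimulatesWithin M l e c' u t) : SimulatesWithin M l e (c + c') s t := by
  intro a π hπ
  obtain ⟨ν, hν, hle⟩ := h a π hπ
  obtain ⟨π', hπ', hle'⟩ := h' a ν hν
  refine ⟨π', hπ', ?_⟩
  calc l * transportCost e π π'
      ≤ l * (transportCost e π ν + transportCost e ν π') :=
        mul_le_mul_right (he.transportCost.triangle π ν π') l
    _ = l * transportCost e π ν + l * transportCost e ν π' := mul_add _ _ _
    _ ≤ c + c' := add_le_add hle hle'

variable (M l) in
/-- The functional whose prefixed points are, up to the bound `1` and the pseudometric axioms,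
the `l`-bisimulation metrics on `M`. It sends every pair to a distance of at most `1`, because
distances from `1` on are not restricted. -/
noncomputable def bisimulationFunctional : (T → T → ℝ≥0∞) →o (T → T → ℝ≥0∞) where
  toFun e s t := sInf {c | c < 1 → SimulatesWithin M l e c s t ∧ SimulatesWithin M l e c t s}
  monotone' _ _ he _ _ := sInf_le_sInf fun _ hc hlt =>
    ⟨(hc hlt).1.mono he le_rfl, (hc hlt).2.mono he le_rfl⟩

theorem bisimulationFunctional_le_of_symm {I : Type*} {f : I → T} {C : I → I → ℝ≥0∞}
    (hC : ∀ i j, C i j = C j i) (h : ∀ i j, C i j < 1 → SimulatesWithin M l e (C i j) (f i) (f j))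
    (i j : I) : bisimulationFunctional M l e (f i) (f j) ≤ C i j :=
  sInf_le fun hlt => ⟨h i j hlt, hC i j ▸ h j i (hC i j ▸ hlt)⟩

theorem simulatesWithin_bisimulationFunctional (hM : ImageFinite M)
    (h : bisimulationFunctional M l e s t < 1) :
    SimulatesWithin M l e (bisimulationFunctional M l e s t) s t := by
  intro a π hπ
  obtain ⟨c, hc, hlt⟩ := sInf_lt_iff.1 h
  obtain ⟨ν, hν, -⟩ := (hc hlt).1 a π hπ
  obtain ⟨π', hπ', hmin⟩ :=
    Set.exists_min_image _ (fun π' => l * transportCost e π π') (hM t a) ⟨ν, hν⟩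
  refine ⟨π', hπ', le_of_forall_gt fun b hb => ?_⟩
  obtain ⟨c, hc, hcb⟩ := sInf_lt_iff.1 (lt_min hb h)
  obtain ⟨ν, hν, hle⟩ := (hc (hcb.trans_le (min_le_right _ _))).1 a π hπ
  exact (hmin ν hν).trans_lt (hle.trans_lt (hcb.trans_le (min_le_left _ _)))

theorem bisimulationFunctional_comm (s t : T) :
    bisimulationFunctional M l e s t = bisimulationFunctional M l e t s :=
  congrArg sInf (Set.ext fun _ => imp_congr_right fun _ => and_comm)

theorem IsPseudoEMetric.bisimulationFunctional (hM : ImageFinite M) (he : IsPseudoEMetric e) :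
    IsPseudoEMetric (bisimulationFunctional M l e) where
  self t := nonpos_iff_eq_zero.1 (sInf_le fun _ => ⟨.refl he.self t, .refl he.self t⟩)
  comm := bisimulationFunctional_comm
  triangle s u t := by
    refine bisimulationFunctional_le_of_symm (f := id)
      (C := fun s t => ProcCalc.bisimulationFunctional M l e s u +
        ProcCalc.bisimulationFunctional M l e u t) (fun s t => ?_) (fun s t hlt => ?_) s t
    · rw [bisimulationFunctional_comm s u, bisimulationFunctional_comm u t, add_comm]
    · exact (simulatesWithin_bisimulationFunctional hM (le_self_add.trans_lt hlt)).trans he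
        (simulatesWithin_bisimulationFunctional hM (le_add_self.trans_lt hlt))

variable (M l) in
/-- The `l`-bisimilarity metric with values in `[0, ∞]`, as the least fixed point of the
bisimulation functional. -/
noncomputable def bisimilarityDist : T → T → ℝ≥0∞ := (bisimulationFunctional M l).lfp

theorem bisimulationFunctional_bisimilarityDist :
    bisimulationFunctional M l (bisimilarityDist M l) = bisimilarityDist M l :=
  (bisimulationFunctional M l).map_lfp

theorem bisimilarityDist_le_one (s t : T) : bisimilarityDist M l s t ≤ 1 := by
  rw [← bisimulationFunctional_bisimilarityDist]
  exact sInf_le fun h => absurd h (lt_irrefl 1)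

theorem bisimilarityDist_ne_top (s t : T) : bisimilarityDist M l s t ≠ ∞ :=
  ((bisimilarityDist_le_one s t).trans_lt ENNReal.one_lt_top).ne

theorem isPseudoEMetric_bisimilarityDist (hM : ImageFinite M) :
    IsPseudoEMetric (bisimilarityDist M l) :=
  (bisimulationFunctional M l).lfp_induction (fun _ he _ => he.bisimulationFunctional hM)
    fun _ => IsPseudoEMetric.sSup

theorem simulatesWithin_bisimilarityDist (hM : ImageFinite M) (h : bisimilarityDist M l s t < 1) :
    SimulatesWithin M l (bisimilarityDist M l) (bisimilarityDist M l s t) s t := by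
  have hfix := congrFun₂ (bisimulationFunctional_bisimilarityDist (M := M) (l := l)) s t
  exact hfix ▸ simulatesWithin_bisimulationFunctional hM (hfix ▸ h)

theorem not_transition_of_bisimilarityDist_lt_one (hM : ImageFinite M)
    (h : bisimilarityDist M l s t < 1) {a : A} (hs : ∀ π, ¬ M s a π) (π : PMF T) : ¬ M t a π := by
  rw [(isPseudoEMetric_bisimilarityDist hM).comm] at h
  intro hπ
  obtain ⟨π', hπ', -⟩ := simulatesWithin_bisimilarityDist hM h a π hπ
  exact hs π' hπ'

theorem bisimilarityDist_le_of_symm {I : Type*} {f : I → T} {C : I → I → ℝ≥0∞}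
    (hC : ∀ i j, C i j = C j i)
    (h : ∀ i j, C i j < 1 → SimulatesWithin M l (bisimilarityDist M l) (C i j) (f i) (f j))
    (i j : I) : bisimilarityDist M l (f i) (f j) ≤ C i j := by
  rw [← bisimulationFunctional_bisimilarityDist]
  exact bisimulationFunctional_le_of_symm hC h i j

theorem bisimilarityDist_le_of_forall_simulatesWithin (he : ∀ s t, e s t = e t s)
    (h : ∀ s t, e s t < 1 → SimulatesWithin M l e (e s t) s t) : bisimilarityDist M l ≤ e :=
  (bisimulationFunctional M l).lfp_le (bisimulationFunctional_le_of_symm (f := id) he h)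

end Bisimilarity

/-! ### The real-valued bisimilarity metric -/

section Metric

variable {S : Signature} {A : Type*} {M : PTS S A} {lam : ℝ} {d : Proc S → Proc S → ℝ}

theorem isBisimulationMetric_iff_simulatesWithin (hlam : 0 ≤ lam) :
    IsBisimulationMetric M lam d ↔ IsPseudometric d ∧ ∀ s t, ENNReal.ofReal (d s t) < 1 →
      SimulatesWithin M (ENNReal.ofReal lam) (fun s t => ENNReal.ofReal (d s t))
        (ENNReal.ofReal (d s t)) s t := by
  refine and_congr_right fun hd => ?_
  simp only [SimulatesWithin, ENNReal.ofReal_lt_one, ← ofReal_kantorovich hd.nonneg hd.le_one,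
    ← ENNReal.ofReal_mul hlam, ENNReal.ofReal_le_ofReal_iff (hd.nonneg _ _)]

theorem isPseudometric_toReal_bisimilarityDist {l : ℝ≥0∞} (hM : ImageFinite M) :
    IsPseudometric fun s t => (bisimilarityDist M l s t).toReal where
  nonneg _ _ := ENNReal.toReal_nonneg
  le_one s t := ENNReal.toReal_le_of_le_ofReal zero_le_one
    (ENNReal.ofReal_one ▸ bisimilarityDist_le_one s t)
  self t := by rw [(isPseudoEMetric_bisimilarityDist hM).self, ENNReal.toReal_zero]
  symm s t := by rw [(isPseudoEMetric_bisimilarityDist hM).comm]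
  triangle s t u := by
    rw [← ENNReal.toReal_add (bisimilarityDist_ne_top _ _) (bisimilarityDist_ne_top _ _)]
    exact ENNReal.toReal_mono
      (ENNReal.add_ne_top.2 ⟨bisimilarityDist_ne_top _ _, bisimilarityDist_ne_top _ _⟩)
      ((isPseudoEMetric_bisimilarityDist hM).triangle s u t)

theorem isLeast_toReal_bisimilarityDist (hM : ImageFinite M) (hlam : 0 ≤ lam) :
    IsLeast {d | IsBisimulationMetric M lam d}
      fun s t => (bisimilarityDist M (ENNReal.ofReal lam) s t).toReal := by
  constructor
  · refine (isBisimulationMetric_iff_simulatesWithin hlam).2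
      ⟨isPseudometric_toReal_bisimilarityDist hM, fun s t h => ?_⟩
    simp only [ENNReal.ofReal_toReal (bisimilarityDist_ne_top _ _)] at h ⊢
    exact simulatesWithin_bisimilarityDist hM h
  · intro d hd s t
    obtain ⟨hp, hsim⟩ := (isBisimulationMetric_iff_simulatesWithin hlam).1 hd
    exact ENNReal.toReal_le_of_le_ofReal (hp.nonneg s t)
      (bisimilarityDist_le_of_forall_simulatesWithin (fun s t => by rw [hp.symm]) hsim s t)

theorem bisimilarityMetric_eq_of_isLeast (h : IsLeast {d | IsBisimulationMetric M lam d} d) :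
    bisimilarityMetric M lam = d := by
  funext s t
  refine IsLeast.csInf_eq ⟨⟨d, h.1, rfl⟩, ?_⟩
  rintro _ ⟨d', hd', rfl⟩
  exact h.2 hd' s t

theorem bisimilarityMetric_eq_toReal_bisimilarityDist (hM : ImageFinite M) (hlam : 0 ≤ lam) :
    bisimilarityMetric M lam = fun s t => (bisimilarityDist M (ENNReal.ofReal lam) s t).toReal :=
  bisimilarityMetric_eq_of_isLeast (isLeast_toReal_bisimilarityDist hM hlam)

theorem isLeast_bisimilarityMetric (hM : ImageFinite M) (hlam : 0 ≤ lam) :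
    IsLeast {d | IsBisimulationMetric M lam d} (bisimilarityMetric M lam) :=
  bisimilarityMetric_eq_toReal_bisimilarityDist hM hlam ▸ isLeast_toReal_bisimilarityDist hM hlam

end Metric

/-! ### Transitions of the operators -/

section Transitions

variable {S : Signature} {A : Type*} {n : ℕ}

/-- The instance of the rule `r` given by `σ` derives the distribution `π`: its premises hold in
`M` for some choice of the distributions reached by the positive ones, and its target then denotes
`π`. -/
def Rule.Justifies (r : Rule S A n) (M : PTS S A) (σ : Fin n → Proc S) (π : PMF (Proc S)) : Prop :=
  ∃ ρ : Fin r.numPos → PMF (Proc S), (∀ k, M (σ (r.pos k).1) (r.pos k).2 (ρ k)) ∧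
    (∀ q ∈ r.neg, ∀ π', ¬ M (σ q.1) q.2 π') ∧ π = r.target.eval σ ρ

variable {M : PTS S A} {σ : Fin n → Proc S} {π : PMF (Proc S)}

theorem Rule.justifies_one_pos_iff {i : Fin n} {a : A} {θ : DTerm S (Fin n) (Fin 1)} :
    Rule.Justifies ⟨1, ![(i, a)], ∅, θ⟩ M σ π ↔ ∃ μ, M (σ i) a μ ∧ π = θ.eval σ ![μ] := by
  simp only [Rule.Justifies, Fin.exists_fin_succ_pi, Fin.exists_fin_zero_pi, Fin.forall_fin_one,
    Fin.cons_zero, Matrix.cons_val_fin_one, Finset.notMem_empty, IsEmpty.forall_iff, implies_true,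
    true_and, exists_and_left]
  rfl

theorem Rule.justifies_one_pos_one_neg_iff {i j : Fin n} {a b : A}
    {θ : DTerm S (Fin n) (Fin 1)} :
    Rule.Justifies ⟨1, ![(i, a)], {(j, b)}, θ⟩ M σ π ↔
      ∃ μ, M (σ i) a μ ∧ (∀ ν, ¬ M (σ j) b ν) ∧ π = θ.eval σ ![μ] := by
  simp only [Rule.Justifies, Fin.exists_fin_succ_pi, Fin.exists_fin_zero_pi, Fin.forall_fin_one,
    Fin.cons_zero, Matrix.cons_val_fin_one, Finset.mem_singleton, forall_eq, exists_and_left]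
  rfl

theorem Rule.justifies_two_pos_iff {i j : Fin n} {a b : A} {θ : DTerm S (Fin n) (Fin 2)} :
    Rule.Justifies ⟨2, ![(i, a), (j, b)], ∅, θ⟩ M σ π ↔
      ∃ μ ν, M (σ i) a μ ∧ M (σ j) b ν ∧ π = θ.eval σ ![μ, ν] := by
  simp only [Rule.Justifies, Fin.exists_fin_succ_pi, Fin.exists_fin_zero_pi, Fin.forall_fin_two,
    Fin.cons_zero, Fin.cons_one, Matrix.cons_val_zero, Matrix.cons_val_one,
    Matrix.cons_val_fin_one, Finset.notMem_empty, IsEmpty.forall_iff, implies_true, true_and,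
    and_assoc, exists_and_left]
  rfl

theorem Rule.finite_justifies (r : Rule S A n)
    (h : ∀ k, {μ | M (σ (r.pos k).1) (r.pos k).2 μ}.Finite) : {π | r.Justifies M σ π}.Finite := by
  refine ((Set.Finite.pi h).image (r.target.eval σ)).subset ?_
  rintro _ ⟨ρ, hρ, -, rfl⟩
  exact ⟨ρ, fun k _ => hρ k, rfl⟩

theorem model_op_iff {P : PTSS S A} {f : S n} {a : A} :
    P.model (.op f σ) a π ↔ ∃ r ∈ P.rules f a, r.Justifies P.model σ π := by
  simp only [PTSS.model, Rule.Justifies]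

theorem imageFinite_model (P : PTSS S A) : ImageFinite P.model := by
  intro t
  induction t with
  | var x => exact x.elim
  | op f σ ih =>
    intro a
    refine ((P.finite_rules f a).biUnion fun r _ =>
      r.finite_justifies fun k => ih (r.pos k).1 (r.pos k).2).subset fun π hπ => ?_
    obtain ⟨r, hr, hJ⟩ := model_op_iff.1 hπ
    exact Set.mem_biUnion hr hJ

theorem IsDisjointExtension.model_op_iff {S' : Signature} {ι : ∀ n, S' n → S n} {P' : PTSS S' A}
    {P : PTSS S A} (hP : IsDisjointExtension ι P' P) {f : S' n} {a : A} :
    P.model (.op (ι n f) σ) a π ↔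
      ∃ r ∈ P'.rules f a, (r.mapSig ι).Justifies P.model σ π := by
  rw [ProcCalc.model_op_iff, hP.rules_eq, Set.exists_mem_image]

end Transitions

section Evaluation

theorem piPMF_two {α : Type*} (π : Fin 2 → PMF α) :
    piPMF π = (π 0).bind fun x => (π 1).map fun y => ![x, y] := by
  simp only [piPMF, PMF.map_bind, PMF.pure_map]
  rfl

variable {A : Type*} {S : Signature} {ι : ∀ n, PAOp A n → S n} {V D : Type*} {σ : V → Proc S}
  {ρ : D → PMF (Proc S)}

theorem eval_var (k : D) : ((DTerm.var k : DTerm (PAOp A) V D).mapSig ι).eval σ ρ = ρ k := rfl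

theorem eval_d2 (f : PAOp A 2) (θ₁ θ₂ : DTerm (PAOp A) V D) :
    ((d2 f θ₁ θ₂).mapSig ι).eval σ ρ = ((θ₁.mapSig ι).eval σ ρ).bind fun s =>
      ((θ₂.mapSig ι).eval σ ρ).map fun t => .op (ι 2 f) ![s, t] := by
  simp only [d2, DTerm.mapSig, DTerm.eval, piPMF_two, PMF.map_bind, PMF.map_comp]
  rfl

theorem eval_d2_dirac_right (f : PAOp A 2) (θ : DTerm (PAOp A) V D) (t : Term (PAOp A) V) :
    ((d2 f θ (.dirac t)).mapSig ι).eval σ ρ =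
      ((θ.mapSig ι).eval σ ρ).map fun s => .op (ι 2 f) ![s, (t.mapSig ι).subst σ] := by
  rw [eval_d2]
  simp only [DTerm.mapSig, DTerm.eval, PMF.pure_map]
  rfl

theorem eval_dMix (p : Set.Ioo (0 : ℝ) 1) (θ₁ θ₂ : DTerm (PAOp A) V D) :
    ((dMix p θ₁ θ₂).mapSig ι).eval σ ρ = (coin p).bind fun b =>
      bif b then (θ₁.mapSig ι).eval σ ρ else (θ₂.mapSig ι).eval σ ρ := by
  simp only [dMix, DTerm.mapSig, DTerm.eval]
  congr 1
  funext b
  cases b <;> rfl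

theorem eval_dNil :
    ((dNil : DTerm (PAOp A) V D).mapSig ι).eval σ ρ = PMF.pure (.op (ι 0 .nil) ![]) := by
  simp only [dNil, DTerm.mapSig, DTerm.eval, Term.mapSig, Term.subst]
  congr 2
  exact Subsingleton.elim _ _

theorem eval_d2_dVar_right (f : PAOp A 2) (k : D) (i : V) :
    ((d2 f (.var k) (dVar i)).mapSig ι).eval σ ρ =
      (ρ k).map fun s => .op (ι 2 f) ![s, σ i] :=
  eval_d2_dirac_right f (.var k) (.var i)

theorem eval_d2_dVar_left (f : PAOp A 2) (k : D) (i : V) :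
    ((d2 f (dVar i) (.var k)).mapSig ι).eval σ ρ =
      (ρ k).map fun s => .op (ι 2 f) ![σ i, s] :=
  (eval_d2 f (dVar i) (.var k)).trans (PMF.pure_bind _ _)

theorem eval_d2_dOp1 {σ : Fin 1 → Proc S} (g : PAOp A 2) (f : PAOp A 1) (k : D) :
    ((d2 g (.var k) (dOp1 f 0)).mapSig ι).eval σ ρ =
      (ρ k).map fun s => .op (ι 2 g) ![s, .op (ι 1 f) σ] := by
  rw [dOp1, eval_d2_dirac_right]
  simp only [Term.mapSig, Term.subst, DTerm.mapSig, DTerm.eval]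
  congr! 6
  exact funext (Fin.forall_fin_one.2 rfl)

theorem eval_d2_dOp2 {σ : Fin 2 → Proc S} (g f : PAOp A 2) (k : D) :
    ((d2 g (.var k) (dOp2 f 0 1)).mapSig ι).eval σ ρ =
      (ρ k).map fun s => .op (ι 2 g) ![s, .op (ι 2 f) σ] := by
  rw [dOp2, eval_d2_dirac_right]
  simp only [Term.mapSig, Term.subst, DTerm.mapSig, DTerm.eval]
  congr! 6
  exact funext (Fin.forall_fin_two.2 ⟨rfl, rfl⟩)

end Evaluation

section AlgebraOperators

variable {A : Type*} {tick : A} {S : Signature} {P : PTSS S A} {ι : ∀ n, PAOp A n → S n} {a : A}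
  {π : PMF (Proc S)}

theorem model_seq_iff (hP : IsDisjointExtension ι (paSpec tick) P) {σ : Fin 2 → Proc S} :
    P.model (.op (ι 2 .seq) σ) a π ↔
      (a ≠ tick ∧ ∃ μ, P.model (σ 0) a μ ∧ π = μ.map fun s => .op (ι 2 .seq) ![s, σ 1]) ∨
      ((∃ μ, P.model (σ 0) tick μ) ∧ P.model (σ 1) a π) := by
  simp only [hP.model_op_iff, paSpec, paRules, Set.mem_union, Set.mem_ofPred_eq, or_and_right,
    and_assoc, exists_or, exists_and_left, exists_eq_left, Rule.mapSig,
    Rule.justifies_one_pos_iff, Rule.justifies_two_pos_iff, eval_var, eval_d2_dVar_right,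
    Matrix.cons_val_zero, Matrix.cons_val_one, exists_and_right, exists_eq_right']

theorem model_async_iff (hP : IsDisjointExtension ι (paSpec tick) P) {σ : Fin 2 → Proc S} :
    P.model (.op (ι 2 .async) σ) a π ↔
      (a ≠ tick ∧ ∃ μ, P.model (σ 0) a μ ∧ π = μ.map fun s => .op (ι 2 .async) ![s, σ 1]) ∨
      (a ≠ tick ∧ ∃ ν, P.model (σ 1) a ν ∧ π = ν.map fun t => .op (ι 2 .async) ![σ 0, t]) ∨
      (a = tick ∧ (∃ μ, P.model (σ 0) tick μ) ∧ (∃ ν, P.model (σ 1) tick ν) ∧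
        π = PMF.pure (.op (ι 0 .nil) ![])) := by
  simp only [hP.model_op_iff, paSpec, paRules, Set.mem_union, Set.mem_ofPred_eq, or_and_right,
    or_assoc, and_assoc, exists_or, exists_and_left, exists_eq_left, Rule.mapSig,
    Rule.justifies_one_pos_iff, Rule.justifies_two_pos_iff, eval_d2_dVar_right, eval_d2_dVar_left,
    eval_dNil, Matrix.cons_val_zero, exists_and_right]

theorem model_unfold_iff (hP : IsDisjointExtension ι (paSpec tick) P) {f : PAOp A 1}
    {g : PAOp A 2} (hf : paRules tick f a =
      {r | a ≠ tick ∧ r = ⟨1, ![(0, a)], ∅, d2 g (.var 0) (dOp1 f 0)⟩}) {σ : Fin 1 → Proc S} :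
    P.model (.op (ι 1 f) σ) a π ↔ a ≠ tick ∧ ∃ μ, P.model (σ 0) a μ ∧
      π = μ.map fun s => .op (ι 2 g) ![s, .op (ι 1 f) σ] := by
  simp only [hP.model_op_iff, paSpec, hf, Set.mem_ofPred_eq, and_assoc, exists_and_left,
    exists_eq_left, Rule.mapSig, Rule.justifies_one_pos_iff, eval_d2_dOp1, Matrix.cons_val_zero]

theorem model_star_iff (hP : IsDisjointExtension ι (paSpec tick) P) {σ : Fin 2 → Proc S} :
    P.model (.op (ι 2 .star) σ) a π ↔
      (a ≠ tick ∧ ∃ μ, P.model (σ 0) a μ ∧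
        π = μ.map fun s => .op (ι 2 .seq) ![s, .op (ι 2 .star) σ]) ∨
      P.model (σ 1) a π := by
  simp only [hP.model_op_iff, paSpec, paRules, Set.mem_union, Set.mem_ofPred_eq, or_and_right,
    and_assoc, exists_or, exists_and_left, exists_eq_left, Rule.mapSig,
    Rule.justifies_one_pos_iff, eval_var, eval_d2_dOp2, Matrix.cons_val_zero, exists_eq_right']

theorem model_starP_iff (hP : IsDisjointExtension ι (paSpec tick) P) {p : Set.Ioo (0 : ℝ) 1}
    {σ : Fin 2 → Proc S} :
    P.model (.op (ι 2 (.starP p)) σ) a π ↔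
      (a ≠ tick ∧ ∃ μ ν, P.model (σ 0) a μ ∧ P.model (σ 1) a ν ∧ π = (coin p).bind fun b =>
        bif b then ν else μ.map fun s => .op (ι 2 .seq) ![s, .op (ι 2 (.starP p)) σ]) ∨
      (a ≠ tick ∧ ∃ μ, P.model (σ 0) a μ ∧ (∀ ν, ¬ P.model (σ 1) a ν) ∧
        π = μ.map fun s => .op (ι 2 .seq) ![s, .op (ι 2 (.starP p)) σ]) ∨
      (a ≠ tick ∧ P.model (σ 1) a π ∧ ∀ μ, ¬ P.model (σ 0) a μ) ∨
      (a = tick ∧ P.model (σ 1) tick π) := by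
  simp only [hP.model_op_iff, paSpec, paRules, Set.mem_union, Set.mem_ofPred_eq, or_and_right,
    or_assoc, and_assoc, exists_or, exists_and_left, exists_eq_left, Rule.mapSig,
    Rule.justifies_one_pos_iff, Rule.justifies_two_pos_iff, Rule.justifies_one_pos_one_neg_iff,
    eval_var, eval_dMix, eval_d2_dOp2, Matrix.cons_val_zero, Matrix.cons_val_one,
    exists_eq_right', exists_eq_right_right']

end AlgebraOperators

/-! ### Moduli of continuity of the operators -/

section Modulus

variable {S : Signature} {A : Type*} {n : ℕ} {M : PTS S A} {l : ℝ≥0∞} {f : S n}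

theorem forall_lt_one_of_sum_lt_one {e : Fin n → ℝ≥0∞} (h : ∑ i, e i < 1) (i : Fin n) : e i < 1 :=
  (Finset.single_le_sum_of_canonicallyOrdered (Finset.mem_univ i)).trans_lt h

/-- The operator `f` does not expand distances, measured by `e` for the results and by the sum of
the `e'`-distances for the arguments. In a fixed point induction, `e'` is the
least fixed point and `e` approximates it. -/
def IsNonexpansiveOp (e e' : Proc S → Proc S → ℝ≥0∞) (f : S n) : Prop :=
  ∀ σ τ : Fin n → Proc S, e (.op f σ) (.op f τ) ≤ ∑ i, e' (σ i) (τ i)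

theorem IsNonexpansiveOp.apply_two {e e' : Proc S → Proc S → ℝ≥0∞} {f : S 2}
    (h : IsNonexpansiveOp e e' f) (s s' t t' : Proc S) :
    e (.op f ![s, s']) (.op f ![t, t']) ≤ e' s t + e' s' t' :=
  (h _ _).trans_eq (Fin.sum_univ_two _)

/-- The estimate satisfied by an operator `f` that recurs after one step: the recursive occurrence
of `f` contributes its own distance, discounted by `l`. -/
def HasRecursiveBound (e : Proc S → Proc S → ℝ≥0∞) (l : ℝ≥0∞) (f : S n) : Prop :=
  ∀ σ τ : Fin n → Proc S, e (.op f σ) (.op f τ) ≤ ∑ i, e (σ i) (τ i) + l * e (.op f σ) (.op f τ)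

theorem isNonexpansiveOp_bisimilarityDist (hM : ImageFinite M)
    (h : ∀ e ≤ bisimilarityDist M l, IsNonexpansiveOp e (bisimilarityDist M l) f →
      ∀ σ τ, (∀ i, bisimilarityDist M l (σ i) (τ i) < 1) →
        SimulatesWithin M l e (∑ i, bisimilarityDist M l (σ i) (τ i)) (.op f σ) (.op f τ)) :
    IsNonexpansiveOp (bisimilarityDist M l) (bisimilarityDist M l) f := by
  -- Only the distance of the results is approximated, so that the arguments keep simulating each
  -- other within their distances.
  refine (bisimulationFunctional M l).lfp_induction
    (p := fun e => IsNonexpansiveOp e (bisimilarityDist M l) f)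
    (fun e he hle => bisimulationFunctional_le_of_symm (fun σ τ => ?_) fun σ τ hlt =>
      h e hle he σ τ (forall_lt_one_of_sum_lt_one hlt)) (fun E hE σ τ => ?_)
  · simp only [(isPseudoEMetric_bisimilarityDist hM).comm (σ _)]
  · simpa only [sSup_apply, iSup_apply] using iSup_le fun e : E => hE e e.2 σ τ

theorem hasRecursiveBound_bisimilarityDist (hM : ImageFinite M)
    (h : ∀ σ τ, (∀ i, bisimilarityDist M l (σ i) (τ i) < 1) →
      SimulatesWithin M l (bisimilarityDist M l) (∑ i, bisimilarityDist M l (σ i) (τ i) +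
        l * bisimilarityDist M l (.op f σ) (.op f τ)) (.op f σ) (.op f τ)) :
    HasRecursiveBound (bisimilarityDist M l) l f := by
  refine bisimilarityDist_le_of_symm (fun σ τ => ?_) fun σ τ hlt =>
    h σ τ (forall_lt_one_of_sum_lt_one (le_self_add.trans_lt hlt))
  simp only [(isPseudoEMetric_bisimilarityDist hM).comm (σ _),
    (isPseudoEMetric_bisimilarityDist hM).comm (.op f σ)]

theorem isLipschitzOp_bisimilarityMetric (hM : ImageFinite M) {lam : ℝ} (hlam₀ : 0 ≤ lam)
    (hlam₁ : lam < 1)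
    (h : HasRecursiveBound (bisimilarityDist M (ENNReal.ofReal lam)) (ENNReal.ofReal lam) f) :
    IsLipschitzOp (bisimilarityMetric M lam) (1 / (1 - lam)) f := by
  refine ⟨one_div_nonneg.2 (sub_nonneg.2 hlam₁.le), fun σ τ => ?_⟩
  have hsum : ∑ i, bisimilarityDist M (ENNReal.ofReal lam) (σ i) (τ i) ≠ ∞ :=
    ENNReal.sum_ne_top.2 fun i _ => bisimilarityDist_ne_top _ _
  have hmul : ENNReal.ofReal lam *
      bisimilarityDist M (ENNReal.ofReal lam) (.op f σ) (.op f τ) ≠ ∞ :=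
    ENNReal.mul_ne_top ENNReal.ofReal_ne_top (bisimilarityDist_ne_top _ _)
  have hreal := ENNReal.toReal_mono (ENNReal.add_ne_top.2 ⟨hsum, hmul⟩) (h σ τ)
  rw [ENNReal.toReal_add hsum hmul, ENNReal.toReal_mul, ENNReal.toReal_ofReal hlam₀,
    ENNReal.toReal_sum fun i _ => bisimilarityDist_ne_top _ _] at hreal
  rw [bisimilarityMetric_eq_toReal_bisimilarityDist hM hlam₀, one_div_mul_eq_div,
    le_div_iff₀ (sub_pos.2 hlam₁)]
  linarith

end Modulus

section RecursiveOperators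

variable {A : Type*} {tick : A} {S : Signature} {P : PTSS S A} {ι : ∀ n, PAOp A n → S n}
  {l : ℝ≥0∞}

theorem isNonexpansiveOp_seq (hP : IsDisjointExtension ι (paSpec tick) P) (hl : l ≤ 1) :
    IsNonexpansiveOp (bisimilarityDist P.model l) (bisimilarityDist P.model l) (ι 2 .seq) := by
  have hM := imageFinite_model P
  refine isNonexpansiveOp_bisimilarityDist hM fun e hle he σ τ hlt a π hπ => ?_
  have hsim := fun i => simulatesWithin_bisimilarityDist hM (hlt i)
  rw [Fin.sum_univ_two]
  rcases (model_seq_iff hP).1 hπ with ⟨ha, μ, hμ, rfl⟩ | ⟨⟨μ, hμ⟩, hπ⟩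
  · obtain ⟨μ', hμ', hcost⟩ := hsim 0 a μ hμ
    refine ⟨_, (model_seq_iff hP).2 (.inl ⟨ha, μ', hμ', rfl⟩), ?_⟩
    refine (mul_transportCost_map_le (fun s t => he.apply_two s _ t _) hcost).trans ?_
    exact add_le_add_right (mul_le_of_le_one_left' hl) _
  · obtain ⟨μ', hμ', -⟩ := hsim 0 tick μ hμ
    obtain ⟨π', hπ', hcost⟩ := (hsim 1).mono hle le_add_self a π hπ
    exact ⟨π', (model_seq_iff hP).2 (.inr ⟨⟨μ', hμ'⟩, hπ'⟩), hcost⟩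

theorem isNonexpansiveOp_async (hP : IsDisjointExtension ι (paSpec tick) P) (hl : l ≤ 1) :
    IsNonexpansiveOp (bisimilarityDist P.model l) (bisimilarityDist P.model l) (ι 2 .async) := by
  have hM := imageFinite_model P
  refine isNonexpansiveOp_bisimilarityDist hM fun e hle he σ τ hlt a π hπ => ?_
  have hsim := fun i => simulatesWithin_bisimilarityDist hM (hlt i)
  rw [Fin.sum_univ_two]
  rcases (model_async_iff hP).1 hπ with
    ⟨ha, μ, hμ, rfl⟩ | ⟨ha, ν, hν, rfl⟩ | ⟨rfl, ⟨μ, hμ⟩, ⟨ν, hν⟩, rfl⟩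
  · obtain ⟨μ', hμ', hcost⟩ := hsim 0 a μ hμ
    refine ⟨_, (model_async_iff hP).2 (.inl ⟨ha, μ', hμ', rfl⟩), ?_⟩
    refine (mul_transportCost_map_le (fun s t => he.apply_two s _ t _) hcost).trans ?_
    exact add_le_add_right (mul_le_of_le_one_left' hl) _
  · obtain ⟨ν', hν', hcost⟩ := hsim 1 a ν hν
    refine ⟨_, (model_async_iff hP).2 (.inr (.inl ⟨ha, ν', hν', rfl⟩)), ?_⟩
    rw [add_comm]
    refine (mul_transportCost_map_le (fun s t =>
      (he.apply_two _ s _ t).trans_eq (add_comm _ _)) hcost).trans ?_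
    exact add_le_add_right (mul_le_of_le_one_left' hl) _
  · obtain ⟨μ', hμ', -⟩ := hsim 0 a μ hμ
    obtain ⟨ν', hν', -⟩ := hsim 1 a ν hν
    refine ⟨_, (model_async_iff hP).2 (.inr (.inr ⟨rfl, ⟨μ', hμ'⟩, ⟨ν', hν'⟩, rfl⟩)), ?_⟩
    have he_self (t : Proc S) : e t t = 0 :=
      nonpos_iff_eq_zero.1 ((hle t t).trans_eq ((isPseudoEMetric_bisimilarityDist hM).self t))
    rw [transportCost_self he_self, mul_zero]
    exact zero_le

theorem hasRecursiveBound_unfold (hP : IsDisjointExtension ι (paSpec tick) P) {f : PAOp A 1}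
    {g : PAOp A 2} (hf : ∀ a, paRules tick f a =
      {r | a ≠ tick ∧ r = ⟨1, ![(0, a)], ∅, d2 g (.var 0) (dOp1 f 0)⟩})
    (hg : IsNonexpansiveOp (bisimilarityDist P.model l) (bisimilarityDist P.model l) (ι 2 g)) :
    HasRecursiveBound (bisimilarityDist P.model l) l (ι 1 f) := by
  have hM := imageFinite_model P
  refine hasRecursiveBound_bisimilarityDist hM fun σ τ hlt a π hπ => ?_
  obtain ⟨ha, μ, hμ, rfl⟩ := (model_unfold_iff hP (hf a)).1 hπ
  obtain ⟨μ', hμ', hcost⟩ := simulatesWithin_bisimilarityDist hM (hlt 0) a μ hμ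
  rw [Fin.sum_univ_one]
  exact ⟨_, (model_unfold_iff hP (hf a)).2 ⟨ha, μ', hμ', rfl⟩,
    mul_transportCost_map_le (fun s t => hg.apply_two s _ t _) hcost⟩

theorem hasRecursiveBound_star (hP : IsDisjointExtension ι (paSpec tick) P) (hl : l ≤ 1) :
    HasRecursiveBound (bisimilarityDist P.model l) l (ι 2 .star) := by
  have hM := imageFinite_model P
  refine hasRecursiveBound_bisimilarityDist hM fun σ τ hlt a π hπ => ?_
  have hsim := fun i => simulatesWithin_bisimilarityDist hM (hlt i)
  rw [Fin.sum_univ_two]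
  rcases (model_star_iff hP).1 hπ with ⟨ha, μ, hμ, rfl⟩ | hπ
  · obtain ⟨μ', hμ', hcost⟩ := (hsim 0).mono le_rfl le_self_add a μ hμ
    exact ⟨_, (model_star_iff hP).2 (.inl ⟨ha, μ', hμ', rfl⟩),
      mul_transportCost_map_le (fun s t => (isNonexpansiveOp_seq hP hl).apply_two s _ t _) hcost⟩
  · obtain ⟨π', hπ', hcost⟩ := (hsim 1).mono le_rfl (le_add_self.trans le_self_add) a π hπ
    exact ⟨π', (model_star_iff hP).2 (.inr hπ'), hcost⟩

theorem hasRecursiveBound_starP (hP : IsDisjointExtension ι (paSpec tick) P) (hl : l ≤ 1)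
    (p : Set.Ioo (0 : ℝ) 1) :
    HasRecursiveBound (bisimilarityDist P.model l) l (ι 2 (.starP p)) := by
  have hM := imageFinite_model P
  refine hasRecursiveBound_bisimilarityDist hM fun σ τ hlt a π hπ => ?_
  have hsim₀ := (simulatesWithin_bisimilarityDist hM (hlt 0)).mono le_rfl
    (le_self_add (b := bisimilarityDist P.model l (σ 1) (τ 1)))
  have hsim₁ := (simulatesWithin_bisimilarityDist hM (hlt 1)).mono le_rfl
    ((le_add_self (b := bisimilarityDist P.model l (σ 0) (τ 0))).trans (le_self_add
      (b := l * bisimilarityDist P.model l (.op (ι 2 (.starP p)) σ) (.op (ι 2 (.starP p)) τ))))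
  have hnot := fun i => not_transition_of_bisimilarityDist_lt_one hM (hlt i) (a := a)
  have hseq := (isNonexpansiveOp_seq hP hl).apply_two
  rw [Fin.sum_univ_two]
  rcases (model_starP_iff hP).1 hπ with
    ⟨ha, μ, ν, hμ, hν, rfl⟩ | ⟨ha, μ, hμ, hσ₁, rfl⟩ | ⟨ha, hπ, hσ₀⟩ | ⟨rfl, hπ⟩
  · obtain ⟨μ', hμ', hcostμ⟩ := hsim₀ a μ hμ
    obtain ⟨ν', hν', hcostν⟩ := hsim₁ a ν hν
    refine ⟨_, (model_starP_iff hP).2 (.inl ⟨ha, μ', ν', hμ', hν', rfl⟩),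
      mul_transportCost_bind_le (coin p) (Bool.forall_bool.2 ⟨?_, hcostν⟩)⟩
    exact mul_transportCost_map_le (fun s t => hseq s _ t _) hcostμ
  · obtain ⟨μ', hμ', hcost⟩ := hsim₀ a μ hμ
    exact ⟨_, (model_starP_iff hP).2 (.inr (.inl ⟨ha, μ', hμ', hnot 1 hσ₁, rfl⟩)),
      mul_transportCost_map_le (fun s t => hseq s _ t _) hcost⟩
  · obtain ⟨π', hπ', hcost⟩ := hsim₁ a π hπ
    exact ⟨π', (model_starP_iff hP).2 (.inr (.inr (.inl ⟨ha, hπ', hnot 0 hσ₀⟩))), hcost⟩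
  · obtain ⟨π', hπ', hcost⟩ := hsim₁ a π hπ
    exact ⟨π', (model_starP_iff hP).2 (.inr (.inr (.inr ⟨rfl, hπ'⟩))), hcost⟩

end RecursiveOperators

end ProcCalc

theorem mainTheorem8 {A : Type*} (tick : A) {S : ℕ → Type*} (P : PTSS S A)
    (ι : ∀ n, PAOp A n → S n) (hP : IsDisjointExtension ι (paSpec tick) P)
    (lam : ℝ) (hlam₀ : 0 < lam) (hlam₁ : lam < 1) :
    IsLeast {d | IsBisimulationMetric P.model lam d} (bisimilarityMetric P.model lam) ∧
    IsLipschitzOp (bisimilarityMetric P.model lam) (1 / (1 - lam)) (ι 1 .omega) ∧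
    IsLipschitzOp (bisimilarityMetric P.model lam) (1 / (1 - lam)) (ι 2 .star) ∧
    (∀ p : Set.Ioo (0 : ℝ) 1,
      IsLipschitzOp (bisimilarityMetric P.model lam) (1 / (1 - lam)) (ι 2 (.starP p))) ∧
    IsLipschitzOp (bisimilarityMetric P.model lam) (1 / (1 - lam)) (ι 1 .bang) := by
  have hM := imageFinite_model P
  have hl : ENNReal.ofReal lam ≤ 1 := ENNReal.ofReal_le_one.2 hlam₁.le
  have lipschitz {n : ℕ} {f : S n} := isLipschitzOp_bisimilarityMetric (f := f) hM hlam₀.le hlam₁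
  exact ⟨isLeast_bisimilarityMetric hM hlam₀.le,
    lipschitz (hasRecursiveBound_unfold hP (fun _ => rfl) (isNonexpansiveOp_seq hP hl)),
    lipschitz (hasRecursiveBound_star hP hl),
    fun p => lipschitz (hasRecursiveBound_starP hP hl p),
    lipschitz (hasRecursiveBound_unfold hP (fun _ => rfl) (isNonexpansiveOp_async hP hl))⟩
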